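/- Let $\mathbb{T}=\mathbb{R}/\mathbb{Z}$ and let $f=\sum_{m\in\mathbb{Z}}f_m z^m\in\mathbb{Z}[z^{\pm1}]$ be a Laurent polynomial with integer coefficients. Let $$X_f=\Bigl\{x=(x_n)_{n\in\mathbb{Z}}\in\mathbb{T}^{\mathbb{Z}} : \sum_{m\in\mathbb{Z}}f_m x_{n+m}=0 \text{ in } \mathbb{T} \text{ for all } n\in\mathbb{Z}\Bigr\},$$ a closed shift-invariant subgroup of $\mathbb{T}^{\mathbb{Z}}$ with the product topology, and let $\alpha_f$ be the $\mathbb{Z}$-action on $X_f$ by the shift, $(\alpha_f^k x)_n=x_{n+k}$. Let $$\mathsf{m}(f)=\int_0^1\log|f(e^{2\pi i t})|\,dt$$ be the logarithmic Mahler measure of $f$ (for $f=0$ it is not positive). Call a bounded sequence $(w_n)_{n\ge0}$ of complex numbers a non-trivial weight if $\limsup_{N\to\infty}\frac1N\sum_{n=0}^{N-1}|w_n|>0$. A continuous $\mathbb{Z}$-action $\alpha$ on a compact space $X$ is called Bohr chaotic if for every non-trivial weight $(w_n)_{n\ge0}$ there exist a continuous function $\phi\colon X\to\mathbb{C}$ and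 a point $x\in X$ such that $$\limsup_{N\to\infty}\frac1N\Bigl|\sum_{n=0}^{N-1}w_n\,\phi(\alpha^n x)\Bigr|>0.$$ **Theorem.** If $\mathsf{m}(f)>0$, then $(X_f,\alpha_f)$ is Bohr chaotic. -/

import Mathlib

open Filter

/-- A bounded complex sequence `w` whose averages of absolute values have positive upper limit.
(The averages are bounded, so the real `limsup` is the genuine one.) -/
def IsNontrivialWeight (w : ℕ → ℂ) : Prop :=
  (∃ C : ℝ, ∀ n, ‖w n‖ ≤ C) ∧
    0 < limsup (fun N : ℕ => (1 / (N : ℝ)) * ∑ n ∈ Finset.range N, ‖w n‖) atTop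

/-- Bohr chaoticity of a continuous `ℤ`-action `α` on a compact space `X`, the action being given as
a homomorphism from `ℤ` to the group of homeomorphisms of `X`. -/
def BohrChaotic {X : Type*} [TopologicalSpace X] [CompactSpace X]
    (α : Multiplicative ℤ →* (X ≃ₜ X)) : Prop :=
  ∀ w : ℕ → ℂ, IsNontrivialWeight w →
    ∃ (φ : C(X, ℂ)) (x : X),
      0 < limsup (fun N : ℕ => (1 / (N : ℝ)) *
        ‖∑ n ∈ Finset.range N, w n * φ (α (Multiplicative.ofAdd (n : ℤ)) x)‖) atTop

/-- The logarithmic Mahler measure `∫₀¹ log |f(exp(2πit))| dt` of an integer Laurent polynomial. -/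
noncomputable def logMahler (f : LaurentPolynomial ℤ) : ℝ :=
  ∫ t in (0 : ℝ)..1, Real.log
    ‖LaurentPolynomial.eval₂ (Int.castRingHom ℂ)
      (Units.mk0 (Complex.exp (2 * Real.pi * Complex.I * t)) (Complex.exp_ne_zero _)) f‖

/-- The group `X_f` of all `x ∈ 𝕋^ℤ`, `𝕋 = ℝ/ℤ`, with `∑ₘ fₘ x_{n+m} = 0` for all `n`. It carries
the topology induced by the product topology. -/
def principalGroup (f : LaurentPolynomial ℤ) : AddSubgroup (ℤ → UnitAddCircle) where
  carrier := {x | ∀ n : ℤ, ∑ m ∈ f.coeff.support, f.coeff m • x (n + m) = 0}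
  add_mem' {x y} hx hy n := by
    have h := congrArg₂ (· + ·) (hx n) (hy n)
    simpa [Finset.sum_add_distrib, smul_add] using h
  zero_mem' n := by simp
  neg_mem' {x} hx n := by
    have h := congrArg (- ·) (hx n)
    simpa using h

instance principalGroup_compactSpace (f : LaurentPolynomial ℤ) :
    CompactSpace (principalGroup f) := by
  refine isCompact_iff_compactSpace.mp (IsClosed.isCompact ?_)
  have h : (principalGroup f : Set (ℤ → UnitAddCircle)) =
      ⋂ n : ℤ, {x | ∑ m ∈ f.coeff.support, f.coeff m • x (n + m) = 0} := by
    ext x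
    simp [principalGroup]
  rw [h]
  refine isClosed_iInter fun n => isClosed_eq ?_ continuous_const
  exact continuous_finsetSum _ fun m _ => (continuous_apply (n + m)).zsmul _

/-- The shift `(σᵏ x)ₙ = x_{n+k}` on `X_f`. -/
def principalShift (f : LaurentPolynomial ℤ) (k : ℤ) (x : principalGroup f) : principalGroup f :=
  ⟨fun n => x.1 (n + k), fun n => by
    have h := x.2 (n + k)
    simpa [add_right_comm] using h⟩

theorem continuous_principalShift (f : LaurentPolynomial ℤ) (k : ℤ) :
    Continuous (principalShift f k) := by
  refine continuous_induced_rng.2 (continuous_pi fun n => ?_)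
  exact (continuous_apply (n + k)).comp continuous_subtype_val

theorem principalShift_zero (f : LaurentPolynomial ℤ) (x : principalGroup f) :
    principalShift f 0 x = x := by
  apply Subtype.ext
  funext n
  simp [principalShift]

theorem principalShift_add (f : LaurentPolynomial ℤ) (k l : ℤ) (x : principalGroup f) :
    principalShift f (k + l) x = principalShift f k (principalShift f l x) := by
  apply Subtype.ext
  funext n
  simp [principalShift, add_assoc]

/-- The principal algebraic `ℤ`-action `α_f`: the restriction of the shift action to `X_f`. -/
def principalAction (f : LaurentPolynomial ℤ) :
    Multiplicative ℤ →* (principalGroup f ≃ₜ principalGroup f) where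
  toFun k :=
    { toFun := principalShift f k.toAdd
      invFun := principalShift f (-k.toAdd)
      left_inv := fun x => by rw [← principalShift_add, neg_add_cancel, principalShift_zero]
      right_inv := fun x => by rw [← principalShift_add, add_neg_cancel, principalShift_zero]
      continuous_toFun := continuous_principalShift f _
      continuous_invFun := continuous_principalShift f _ }
  map_one' := by
    ext1 x
    exact principalShift_zero f x
  map_mul' k l := by
    ext1 x
    exact principalShift_add f k.toAdd l.toAdd x

/-! The test function is the character `x ↦ exp (2πi x₀)`; moved by the shift it becomes the
character of the monomial `Tⁿ`. The dual of `X_f` is `ℤ[z^{±1}]/(f)`, so under Haar measure the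
character of `g` has integral zero unless `f ∣ g`.

If `2 ∤ f`, positive Mahler measure yields a gap `N` for which the monomials `T^(Nk+r)` are
dissociate modulo `f`. The polynomial associated to `f` has either a root `ζ` with `‖ζ‖ > 1`, where
Cauchy's bound excludes relations once `‖ζ‖^N > 3`, or a leading coefficient of absolute value at
least 2, where leading coefficients and reduction mod 2 exclude them
(`exists_gap_of_logMahler_pos`).

Dissociateness allows a Riesz product `ν` (`exists_rieszProduct`) whose coefficient at `T^(Nk+r)` is
`δ/2` times the conjugate phase of the weight, while at all other `Tⁿ`, `n ≥ 0`, it is at most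
`(δ/2)²`. By pigeonhole some class `r` mod `N` carries a share `1/N` of the weight for infinitely
many averages, and with `δ = 1/N` the main term beats the error. Hence the `ν`-integrals of the
weighted averages do not tend to zero, and by dominated convergence neither do the averages at some
point.

If `2 ∣ f`, dissociateness fails, but `X_f` contains every sequence in `{0, 1/2}`, so signs can be
prescribed freely. -/

/-! ### Riesz products over dissociate characters -/

section RieszProduct

open MeasureTheory Topology ComplexConjugate

/-- The coefficients of the Riesz factor `1 + δ Re (conj c γ) = ∑ₑ rieszCoeff δ c e γᵉ`, where
`e ∈ {-1, 0, 1}`. -/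
noncomputable def rieszCoeff (δ : ℝ) (c : ℂ) (e : ℤ) : ℂ :=
  if e = 0 then 1 else if e = 1 then δ / 2 * conj c else δ / 2 * c

theorem norm_rieszCoeff_le {δ : ℝ} (hδ : 0 ≤ δ) {c : ℂ} (hc : ‖c‖ ≤ 1) (e : ℤ) :
    ‖rieszCoeff δ c e‖ ≤ if e = 0 then 1 else δ / 2 := by
  have h : δ / 2 * ‖c‖ ≤ δ / 2 := mul_le_of_le_one_right (by positivity) hc
  unfold rieszCoeff
  split_ifs
  · simp
  all_goals simpa [abs_of_nonneg hδ] using h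

/-- The `K`-th partial Riesz product of the characters `χ (a k)`. -/
noncomputable def rieszDensity {X A : Type*} [TopologicalSpace X] [AddCommGroup A]
    (χ : AddChar A C(X, ℂ)) (a : ℕ → A) (c : ℕ → ℂ) (δ : ℝ) (K : ℕ) (x : X) : ℝ :=
  ∏ k : Fin K, (1 + δ * (conj (c k) * χ (a k) x).re)

section Expansion

variable {X A : Type*} [TopologicalSpace X] [AddCommGroup A] {χ : AddChar A C(X, ℂ)}

theorem continuous_rieszDensity (a : ℕ → A) (c : ℕ → ℂ) (δ : ℝ) (K : ℕ) :
    Continuous (rieszDensity χ a c δ K) := by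
  unfold rieszDensity
  fun_prop

theorem rieszDensity_nonneg (hχ : ∀ b x, ‖χ b x‖ = 1) (a : ℕ → A) {c : ℕ → ℂ}
    (hc : ∀ k, ‖c k‖ ≤ 1) {δ : ℝ} (hδ : 0 ≤ δ) (hδ' : δ ≤ 1) (K : ℕ) (x : X) :
    0 ≤ rieszDensity χ a c δ K x := by
  refine Finset.prod_nonneg fun k _ => ?_
  have h1 : |(conj (c k) * χ (a k) x).re| ≤ 1 := by
    refine (Complex.abs_re_le_norm _).trans ?_
    simpa [hχ] using hc k
  have h2 : -1 ≤ (conj (c k) * χ (a k) x).re := (abs_le.1 h1).1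
  nlinarith

theorem conj_character_apply (hχ : ∀ b x, ‖χ b x‖ = 1) (b : A) (x : X) :
    conj (χ b x) = χ (-b) x := by
  have h1 : χ b x * χ (-b) x = 1 := by
    rw [← ContinuousMap.mul_apply, ← AddChar.map_add_eq_mul, add_neg_cancel,
      AddChar.map_zero_eq_one, ContinuousMap.one_apply]
  have h2 : χ b x * conj (χ b x) = 1 := by
    rw [Complex.mul_conj, Complex.normSq_eq_norm_sq, hχ]
    simp
  have h3 : χ b x ≠ 0 := fun h => by simp [h] at h1
  exact mul_left_cancel₀ h3 (h2.trans h1.symm)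

theorem riesz_factor_eq_sum (hχ : ∀ b x, ‖χ b x‖ = 1) (b : A) (c : ℂ) (δ : ℝ) (x : X) :
    ((1 + δ * (conj c * χ b x).re : ℝ) : ℂ) =
      ∑ e ∈ ({-1, 0, 1} : Finset ℤ), rieszCoeff δ c e * χ (e • b) x := by
  have h : ((conj c * χ b x).re : ℂ) = (conj c * χ b x + c * χ (-b) x) / 2 := by
    rw [Complex.re_eq_add_conj, map_mul, Complex.conj_conj, conj_character_apply hχ]
  push_cast
  rw [h]
  simp [rieszCoeff]
  ring

theorem character_sum_apply {ι : Type*} (s : Finset ι) (b : ι → A) (x : X) :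
    χ (∑ i ∈ s, b i) x = ∏ i ∈ s, χ (b i) x := by
  classical
  induction s using Finset.induction_on with
  | empty => simp
  | insert i s hi ih => simp [hi, AddChar.map_add_eq_mul, ih]

theorem rieszDensity_mul_character (hχ : ∀ b x, ‖χ b x‖ = 1) (a : ℕ → A) (c : ℕ → ℂ) (δ : ℝ)
    (K : ℕ) (b : A) (x : X) :
    (rieszDensity χ a c δ K x : ℂ) * χ b x =
      ∑ ε ∈ Fintype.piFinset fun _ : Fin K => ({-1, 0, 1} : Finset ℤ),
        (∏ k : Fin K, rieszCoeff δ (c k) (ε k)) * χ (b + ∑ k, ε k • a k) x := by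
  unfold rieszDensity
  rw [Complex.ofReal_prod]
  simp_rw [riesz_factor_eq_sum hχ]
  rw [Finset.prod_univ_sum, Finset.sum_mul]
  refine Finset.sum_congr rfl fun ε _ => ?_
  rw [Finset.prod_mul_distrib, AddChar.map_add_eq_mul, ContinuousMap.mul_apply,
    character_sum_apply]
  ring

theorem norm_integral_character_le [MeasurableSpace X] (μ : Measure X) [IsProbabilityMeasure μ]
    (hχ : ∀ b x, ‖χ b x‖ = 1) (b : A) : ‖∫ x, χ b x ∂μ‖ ≤ 1 := by
  simpa using norm_integral_le_of_norm_le_const (μ := μ) (ae_of_all _ fun x => (hχ b x).le)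

end Expansion

variable {X A : Type*} [TopologicalSpace X] [CompactSpace X] [MeasurableSpace X] [BorelSpace X]
  [AddCommGroup A] {χ : AddChar A C(X, ℂ)}

theorem ContinuousMap.integrable_of_compactSpace (μ : Measure X) [IsFiniteMeasure μ]
    (φ : C(X, ℂ)) : Integrable φ μ :=
  φ.continuous.integrable_of_hasCompactSupport (HasCompactSupport.of_compactSpace _)

/-- `a` is dissociate modulo `B` if no non-trivial combination of the `a k` with coefficients in
`{-2, …, 2}` lies in `B`. -/
def IsDissociate (B : AddSubgroup A) (a : ℕ → A) : Prop :=
  ∀ (K : ℕ) (ε : Fin K → ℤ), (∀ k, |ε k| ≤ 2) → ∑ k, ε k • a k ∈ B → ε = 0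

/-- Two exponent vectors in `{-1, 0, 1}` differ by one in `{-2, …, 2}`, which is why dissociateness
is required up to 2. -/
theorem IsDissociate.unique {B : AddSubgroup A} {a : ℕ → A} (ha : IsDissociate B a) {K : ℕ} {b : A}
    {ε ε' : Fin K → ℤ}
    (hε : ε ∈ Fintype.piFinset fun _ : Fin K => ({-1, 0, 1} : Finset ℤ))
    (hε' : ε' ∈ Fintype.piFinset fun _ : Fin K => ({-1, 0, 1} : Finset ℤ))
    (h : b + ∑ k, ε k • a k ∈ B) (h' : b + ∑ k, ε' k • a k ∈ B) : ε = ε' := by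
  refine sub_eq_zero.1 (ha K _ (fun k => ?_) ?_)
  · have h1 := Fintype.mem_piFinset.1 hε k
    have h2 := Fintype.mem_piFinset.1 hε' k
    simp only [Finset.mem_insert, Finset.mem_singleton] at h1 h2
    rw [Pi.sub_apply, abs_le]
    omega
  · convert B.sub_mem h h' using 1
    simp [sub_smul]

section Coefficients

variable {μ : Measure X} [IsProbabilityMeasure μ] {B : AddSubgroup A}

theorem integral_rieszDensity_mul_character (hχ : ∀ b x, ‖χ b x‖ = 1) (a : ℕ → A) (c : ℕ → ℂ)
    (δ : ℝ) (K : ℕ) (b : A) :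
    ∫ x, (rieszDensity χ a c δ K x : ℂ) * χ b x ∂μ =
      ∑ ε ∈ Fintype.piFinset fun _ : Fin K => ({-1, 0, 1} : Finset ℤ),
        (∏ k : Fin K, rieszCoeff δ (c k) (ε k)) * ∫ x, χ (b + ∑ k, ε k • a k) x ∂μ := by
  simp_rw [rieszDensity_mul_character hχ]
  rw [integral_finsetSum _ fun ε _ =>
    (ContinuousMap.integrable_of_compactSpace μ _).const_mul _]
  simp_rw [integral_const_mul]

/-- By uniqueness, `ε` is the only term of the expansion whose integral can be non-zero. -/
theorem integral_rieszDensity_mul_character_of_mem (hχ : ∀ b x, ‖χ b x‖ = 1)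
    (hB : ∀ b ∉ B, ∫ x, χ b x ∂μ = 0) {a : ℕ → A} (ha : IsDissociate B a) (c : ℕ → ℂ)
    (δ : ℝ) {K : ℕ} {b : A} {ε : Fin K → ℤ}
    (hε : ε ∈ Fintype.piFinset fun _ : Fin K => ({-1, 0, 1} : Finset ℤ))
    (h : b + ∑ k, ε k • a k ∈ B) :
    ∫ x, (rieszDensity χ a c δ K x : ℂ) * χ b x ∂μ =
      (∏ k : Fin K, rieszCoeff δ (c k) (ε k)) * ∫ x, χ (b + ∑ k, ε k • a k) x ∂μ := by
  rw [integral_rieszDensity_mul_character hχ]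
  refine Finset.sum_eq_single_of_mem ε hε fun ε' hε' hne => ?_
  rw [hB _ fun h' => hne (ha.unique hε' hε h' h), mul_zero]

theorem integral_rieszDensity (hχ : ∀ b x, ‖χ b x‖ = 1)
    (hB : ∀ b ∉ B, ∫ x, χ b x ∂μ = 0) {a : ℕ → A} (ha : IsDissociate B a) (c : ℕ → ℂ)
    (δ : ℝ) (K : ℕ) : ∫ x, rieszDensity χ a c δ K x ∂μ = 1 := by
  have h := integral_rieszDensity_mul_character_of_mem hχ hB ha c δ (K := K) (b := 0) (ε := 0)
    (by simp) (by simp)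
  simp [rieszCoeff] at h
  rw [integral_complex_ofReal] at h
  exact_mod_cast h

theorem integral_rieszDensity_mul_generator (hχ : ∀ b x, ‖χ b x‖ = 1)
    (hB : ∀ b ∉ B, ∫ x, χ b x ∂μ = 0) {a : ℕ → A} (ha : IsDissociate B a) (c : ℕ → ℂ)
    (δ : ℝ) {K j : ℕ} (hj : j < K) :
    ∫ x, (rieszDensity χ a c δ K x : ℂ) * χ (a j) x ∂μ = δ / 2 * c j := by
  -- The surviving exponent vector is `-1` at `j` and zero elsewhere; its coefficient is `δ / 2 * c
  -- j`.
  have h0 : a j + ∑ k : Fin K, (-Pi.single ⟨j, hj⟩ 1 : Fin K → ℤ) k • a k = 0 := by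
    simp [Pi.single_apply, ite_smul]
  rw [integral_rieszDensity_mul_character_of_mem hχ hB ha c δ (ε := -Pi.single ⟨j, hj⟩ 1)
    (Fintype.mem_piFinset.2 fun k => ?_) (by rw [h0]; exact B.zero_mem), h0]
  · rw [Finset.prod_eq_single (⟨j, hj⟩ : Fin K)]
    · simp [rieszCoeff]
    · intro k _ hk
      simp [rieszCoeff, hk]
    · simp
  · rcases eq_or_ne k ⟨j, hj⟩ with rfl | hk <;> simp [*]

/-- A surviving `ε` has at least two non-zero entries: none would put `b` in `B`, and one would put
`b ± a j` in `B`. Each such entry costs a factor `δ / 2`. -/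
theorem norm_integral_rieszDensity_mul_le (hχ : ∀ b x, ‖χ b x‖ = 1)
    (hB : ∀ b ∉ B, ∫ x, χ b x ∂μ = 0) {a : ℕ → A} (ha : IsDissociate B a) {c : ℕ → ℂ}
    (hc : ∀ k, ‖c k‖ ≤ 1) {δ : ℝ} (hδ : 0 ≤ δ) (hδ' : δ ≤ 1) (K : ℕ) {b : A} (hb : b ∉ B)
    (hba : ∀ k, b + a k ∉ B ∧ b - a k ∉ B) :
    ‖∫ x, (rieszDensity χ a c δ K x : ℂ) * χ b x ∂μ‖ ≤ (δ / 2) ^ 2 := by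
  by_cases! hex : ∃ ε ∈ Fintype.piFinset fun _ : Fin K => ({-1, 0, 1} : Finset ℤ),
      b + ∑ k, ε k • a k ∈ B
  · obtain ⟨ε, hε, h⟩ := hex
    rw [integral_rieszDensity_mul_character_of_mem hχ hB ha c δ hε h, norm_mul]
    have hcard : 1 < (Finset.univ.filter fun k => ε k ≠ 0).card := by
      by_contra! hle
      rcases Nat.le_one_iff_eq_zero_or_eq_one.1 hle with h0 | h1
      · rw [Finset.card_eq_zero, Finset.filter_eq_empty_iff] at h0
        have : ∀ k, ε k = 0 := fun k => by simpa using h0 (Finset.mem_univ k)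
        exact hb (by simpa [this] using h)
      · obtain ⟨j, hj⟩ := Finset.card_eq_one.1 h1
        have hsum : ∑ k, ε k • a k = ε j • a j := by
          refine Finset.sum_eq_single j (fun k _ hk => ?_) (by simp)
          have : k ∉ Finset.univ.filter fun k => ε k ≠ 0 := by simp [hj, hk]
          have hk0 : ε k = 0 := by simpa using this
          rw [hk0, zero_smul]
        have hjmem : ε j ≠ 0 := by
          have : j ∈ Finset.univ.filter fun k => ε k ≠ 0 := by simp [hj]
          simpa using this
        rw [hsum] at h
        have hj' := Fintype.mem_piFinset.1 hε j
        simp only [Finset.mem_insert, Finset.mem_singleton] at hj'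
        rcases hj' with hj' | hj' | hj'
        · exact (hba j).2 (by simpa [hj', sub_eq_add_neg] using h)
        · exact hjmem hj'
        · exact (hba j).1 (by simpa [hj'] using h)
    have hprod : ‖∏ k : Fin K, rieszCoeff δ (c k) (ε k)‖ ≤ (δ / 2) ^ 2 := by
      rw [norm_prod]
      calc ∏ k : Fin K, ‖rieszCoeff δ (c k) (ε k)‖
          ≤ ∏ k : Fin K, (if ε k = 0 then 1 else δ / 2) :=
            Finset.prod_le_prod (fun _ _ => norm_nonneg _)
              fun k _ => norm_rieszCoeff_le hδ (hc k) _
        _ = (δ / 2) ^ (Finset.univ.filter fun k => ε k ≠ 0).card := by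
            rw [Finset.prod_ite, Finset.prod_const_one, one_mul, Finset.prod_const]
        _ ≤ (δ / 2) ^ 2 :=
            pow_le_pow_of_le_one (by positivity) (by linarith) hcard
    calc _ ≤ (δ / 2) ^ 2 * 1 :=
          mul_le_mul hprod (norm_integral_character_le μ hχ _) (norm_nonneg _) (by positivity)
      _ = _ := mul_one _
  · rw [integral_rieszDensity_mul_character hχ, Finset.sum_eq_zero, norm_zero]
    · positivity
    · intro ε hε
      rw [hB _ (hex ε hε), mul_zero]

end Coefficients

/-- Existence of the Riesz product measure `∏ₖ (1 + δ Re (conj (c k) χ (a k))) dμ` attached to a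
dissociate sequence of characters. -/
theorem exists_rieszProduct [T2Space X] (μ : Measure X) [IsProbabilityMeasure μ]
    {B : AddSubgroup A} (hχ : ∀ b x, ‖χ b x‖ = 1)
    (hB : ∀ b ∉ B, ∫ x, χ b x ∂μ = 0) {a : ℕ → A} (ha : IsDissociate B a) {c : ℕ → ℂ}
    (hc : ∀ k, ‖c k‖ ≤ 1) {δ : ℝ} (hδ : 0 ≤ δ) (hδ' : δ ≤ 1) :
    ∃ ν : ProbabilityMeasure X, (∀ k, ∫ x, χ (a k) x ∂(ν : Measure X) = δ / 2 * c k) ∧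
      ∀ b ∉ B, (∀ k, b + a k ∉ B ∧ b - a k ∉ B) →
        ‖∫ x, χ b x ∂(ν : Measure X)‖ ≤ (δ / 2) ^ 2 := by
  set p := rieszDensity χ a c δ
  have hp0 : ∀ K x, 0 ≤ p K x := rieszDensity_nonneg hχ a hc hδ hδ'
  have hpc : ∀ K, Continuous (p K) := continuous_rieszDensity a c δ
  have hint : ∀ K, Integrable (p K) μ := fun K =>
    (hpc K).integrable_of_hasCompactSupport (HasCompactSupport.of_compactSpace _)
  have hprob : ∀ K, IsProbabilityMeasure (μ.withDensity fun x => ENNReal.ofReal (p K x)) := by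
    intro K
    refine ⟨?_⟩
    rw [withDensity_apply _ MeasurableSet.univ, Measure.restrict_univ,
      ← ofReal_integral_eq_lintegral_ofReal (hint K) (ae_of_all _ (hp0 K)),
      integral_rieszDensity hχ hB ha c δ K, ENNReal.ofReal_one]
  let ν : ℕ → ProbabilityMeasure X := fun K => ⟨_, hprob K⟩
  have hν : ∀ K b, ∫ x, χ b x ∂(ν K : Measure X) = ∫ x, (p K x : ℂ) * χ b x ∂μ := by
    intro K b
    change ∫ x, χ b x ∂(μ.withDensity fun x => ENNReal.ofReal (p K x)) = _
    rw [integral_withDensity_eq_integral_toReal_smul (hpc K).measurable.ennreal_ofReal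
      (ae_of_all _ fun _ => ENNReal.ofReal_lt_top)]
    refine integral_congr_ae (ae_of_all _ fun x => ?_)
    simp [ENNReal.toReal_ofReal (hp0 K x)]
  -- Probability measures on a compact Hausdorff space form a compact space; a limit along an
  -- ultrafilter needs no metrizability. The coefficient at `a k` is constant once `K > k`, and the
  -- other bounds are uniform in `K`.
  obtain ⟨U, hle⟩ := Ultrafilter.exists_le (atTop : Filter ℕ)
  obtain ⟨ν', -, hν'⟩ := (isCompact_univ (X := ProbabilityMeasure X)).ultrafilter_le_nhds
    (U.map ν) (by simp)
  have hlim : ∀ b, Tendsto (fun K => ∫ x, χ b x ∂(ν K : Measure X)) U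
      (𝓝 (∫ x, χ b x ∂(ν' : Measure X))) := fun b =>
    (ProbabilityMeasure.tendsto_iff_forall_integral_rclike_tendsto ℂ).1 hν'
      (BoundedContinuousFunction.mkOfCompact (χ b))
  refine ⟨ν', fun k => ?_, fun b hb hba => ?_⟩
  · refine tendsto_nhds_unique (hlim (a k)) (tendsto_const_nhds.congr' ?_)
    filter_upwards [hle (eventually_gt_atTop k)] with K hK
    rw [hν, integral_rieszDensity_mul_generator hχ hB ha c δ hK]
  · refine le_of_tendsto (hlim b).norm (Eventually.of_forall fun K => ?_)
    rw [hν]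
    exact norm_integral_rieszDensity_mul_le hχ hB ha hc hδ hδ' K hb hba

end RieszProduct

/-! ### Positive Mahler measure and dissociate powers -/

section Divisibility

open Polynomial

namespace Polynomial

theorem leadingCoeff_dvd_of_dvd_X_pow_mul {p q : ℤ[X]} {s : ℕ} (h : p ∣ X ^ s * q) :
    p.leadingCoeff ∣ q.leadingCoeff := by
  obtain ⟨r, hr⟩ := h
  have := congrArg leadingCoeff hr
  rw [leadingCoeff_mul, leadingCoeff_mul, leadingCoeff_X_pow, one_mul] at this
  exact ⟨_, this⟩

theorem not_dvd_X_pow_mul_of_leadingCoeff {p q : ℤ[X]} (hq : q ≠ 0)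
    (h : |q.leadingCoeff| < |p.leadingCoeff|) (s : ℕ) : ¬ p ∣ X ^ s * q := fun hd =>
  hq (leadingCoeff_eq_zero.1
    (Int.eq_zero_of_abs_lt_dvd ((abs_dvd _ _).2 (leadingCoeff_dvd_of_dvd_X_pow_mul hd)) h))

/-- Here the leading coefficient of `q` must be `±2`. If `2 ∣ q`, cancelling 2 leaves leading
coefficient `±1`, which that of `p` does not divide. Otherwise reduction mod 2 lowers the degree of
`p` but not of the cofactor, whereas the degree of `q(X^N)` falls only by multiples of `N > deg p`.
-/
theorem not_dvd_X_pow_mul_expand_of_leadingCoeff_eq_two {p q : ℤ[X]} (hp : |p.leadingCoeff| = 2)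
    (hp2 : ¬ C 2 ∣ p) (hq : q ≠ 0) (hq2 : ∀ i, |q.coeff i| ≤ 2) (s : ℕ) :
    ¬ p ∣ X ^ s * expand ℤ (p.natDegree + 1) q := by
  intro hd
  set N := p.natDegree + 1 with hN
  have hN0 : 0 < N := Nat.succ_pos _
  have hprime : Prime (C 2 : ℤ[X]) := prime_C_iff.2 Int.prime_two
  have hlc : (expand ℤ N q).leadingCoeff = q.leadingCoeff := leadingCoeff_expand hN0
  have hq0 : q.leadingCoeff ≠ 0 := leadingCoeff_ne_zero.2 hq
  have hq3 : |q.leadingCoeff| = 2 := by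
    have h1 := leadingCoeff_dvd_of_dvd_X_pow_mul hd
    rw [hlc, ← abs_dvd_abs, hp] at h1
    exact le_antisymm (hq2 _) (Int.le_of_dvd (abs_pos.2 hq0) h1)
  obtain ⟨h, hh⟩ := hd
  by_cases h2q : C 2 ∣ q
  · obtain ⟨q', rfl⟩ := h2q
    have hq' : |q'.leadingCoeff| = 1 := by
      rw [leadingCoeff_mul, leadingCoeff_C, abs_mul] at hq3
      norm_num at hq3
      linarith
    have h2 : C 2 ∣ p * h := ⟨X ^ s * expand ℤ N q', by
      rw [← hh, map_mul, expand_C]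
      ring⟩
    obtain ⟨h', rfl⟩ := (hprime.dvd_or_dvd h2).resolve_left hp2
    have hq'0 : q' ≠ 0 := by
      rintro rfl
      simp at hq'
    refine not_dvd_X_pow_mul_of_leadingCoeff (p := p) (q := expand ℤ N q')
      ((expand_ne_zero hN0).2 hq'0) ?_ s ⟨h', mul_left_cancel₀ hprime.ne_zero ?_⟩
    · rw [leadingCoeff_expand hN0, hq', hp]
      norm_num
    · rw [map_mul, expand_C] at hh
      linear_combination hh
  · have hmap : ∀ r : ℤ[X], ¬ C 2 ∣ r → r.map (Int.castRingHom (ZMod 2)) ≠ 0 := by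
      intro r hr h0
      refine hr (C_dvd_iff_dvd_coeff _ _ |>.2 fun i => ?_)
      have := congrArg (fun t => coeff t i) h0
      simpa using (ZMod.intCast_zmod_eq_zero_iff_dvd _ 2).1 (by simpa using this)
    have hlch : |h.leadingCoeff| = 1 := by
      have := congrArg (fun t => |leadingCoeff t|) hh
      simp only [leadingCoeff_mul, leadingCoeff_X_pow, one_mul, hlc, abs_mul, hp, hq3] at this
      linarith
    have hh0 : h ≠ 0 := by
      rintro rfl
      simp at hlch
    have hp0 : p ≠ 0 := by
      rintro rfl
      simp at hp
    have hh2 : ¬ C 2 ∣ h := fun hd => by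
      have h1 := (C_dvd_iff_dvd_coeff _ _).1 hd h.natDegree
      rw [coeff_natDegree, ← dvd_abs, hlch] at h1
      norm_num at h1
    have hdegh : (h.map (Int.castRingHom (ZMod 2))).natDegree = h.natDegree := by
      refine natDegree_map_of_leadingCoeff_ne_zero _ ?_
      rcases (abs_eq zero_le_one).1 hlch with h1 | h1 <;> simp [h1]
    have hdegp : (p.map (Int.castRingHom (ZMod 2))).natDegree < p.natDegree := by
      have hz : Int.castRingHom (ZMod 2) p.leadingCoeff = 0 := by
        rw [eq_intCast, ZMod.intCast_zmod_eq_zero_iff_dvd, ← dvd_abs, hp]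
        norm_num
      exact natDegree_map_lt hz (hmap p hp2)
    have hdeg : s + q.natDegree * N = p.natDegree + h.natDegree := by
      have := congrArg natDegree hh
      rwa [natDegree_mul hp0 hh0, natDegree_mul (pow_ne_zero _ X_ne_zero)
        ((expand_ne_zero hN0).2 hq), natDegree_X_pow, natDegree_expand] at this
    have hdeg2 : s + (q.map (Int.castRingHom (ZMod 2))).natDegree * N =
        (p.map (Int.castRingHom (ZMod 2))).natDegree + h.natDegree := by
      have := congrArg (fun t => natDegree (t.map (Int.castRingHom (ZMod 2)))) hh
      simp only [Polynomial.map_mul, Polynomial.map_pow, map_X, map_expand] at this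
      rwa [natDegree_mul (hmap p hp2) (hmap h hh2), hdegh,
        natDegree_mul (pow_ne_zero _ X_ne_zero) ((expand_ne_zero hN0).2 (hmap q h2q)),
        natDegree_X_pow, natDegree_expand] at this
    -- With `t` the degree lost by `q` mod 2, `t * N` is the degree lost by `p`, which lies between
    -- 1 and `deg p = N - 1`.
    obtain ⟨t, ht⟩ := Nat.exists_eq_add_of_le
      (natDegree_map_le (f := Int.castRingHom (ZMod 2)) (p := q))
    rw [ht, add_mul] at hdeg
    rcases Nat.eq_zero_or_pos t with rfl | ht0
    · lia
    · have := Nat.le_mul_of_pos_left N ht0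
      lia

/-- Cauchy's bound is 1 plus the largest ratio of a lower coefficient to the leading one, here at
most `2 / 1`. -/
theorem norm_lt_three_of_isRoot {q : ℤ[X]} (hq : q ≠ 0) (hq2 : ∀ i, |q.coeff i| ≤ 2) {y : ℂ}
    (hy : aeval y q = 0) : ‖y‖ < 3 := by
  have hinj : Function.Injective (Int.castRingHom ℂ) := RingHom.injective_int _
  have hroot : (q.map (Int.castRingHom ℂ)).IsRoot y := by
    rwa [IsRoot, eval_map, ← algebraMap_int_eq, ← aeval_def]
  have h1 := hroot.norm_lt_cauchyBound ((Polynomial.map_ne_zero_iff hinj).2 hq)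
  have h2 : (cauchyBound (q.map (Int.castRingHom ℂ)) : ℝ) ≤ 3 := by
    have hlc : (1 : NNReal) ≤ ‖(q.map (Int.castRingHom ℂ)).leadingCoeff‖₊ := by
      rw [leadingCoeff_map_of_injective hinj, ← NNReal.coe_le_coe, coe_nnnorm, eq_intCast,
        Complex.norm_intCast, NNReal.coe_one]
      exact_mod_cast Int.one_le_abs (leadingCoeff_ne_zero.2 hq)
    have hsup : (Finset.range (q.map (Int.castRingHom ℂ)).natDegree).sup
        (fun i => ‖(q.map (Int.castRingHom ℂ)).coeff i‖₊) ≤ 2 := by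
      refine Finset.sup_le fun i _ => ?_
      rw [coeff_map, ← NNReal.coe_le_coe, coe_nnnorm, eq_intCast, Complex.norm_intCast]
      simpa using (Int.cast_le (R := ℝ)).2 (hq2 i)
    have h3 : cauchyBound (q.map (Int.castRingHom ℂ)) ≤ 3 := by
      unfold cauchyBound
      calc _ ≤ (2 : NNReal) + 1 := add_le_add_left ((div_le_self zero_le hlc).trans hsup) _
        _ = 3 := by norm_num
    exact_mod_cast h3
  exact lt_of_lt_of_le (by exact_mod_cast h1) h2

theorem not_dvd_X_pow_mul_of_aeval_ne_zero {p q : ℤ[X]} {ζ : ℂ} (hζ : aeval ζ p = 0)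
    (hζ0 : ζ ≠ 0) (hq : aeval ζ q ≠ 0) (s : ℕ) : ¬ p ∣ X ^ s * q := by
  rintro ⟨h, hh⟩
  have h1 := congrArg (aeval ζ) hh
  simp [hζ, hζ0, hq] at h1

end Polynomial

open LaurentPolynomial (T)

/-- `p` and `f` differ by the unit `T k`; `X ^ s` clears the negative powers of the cofactor. -/
theorem LaurentPolynomial.exists_dvd_X_pow_mul {f : LaurentPolynomial ℤ} {p q : ℤ[X]} {k : ℕ}
    (hp : toLaurent p = f * T k) (h : f ∣ toLaurent q) : ∃ s : ℕ, p ∣ X ^ s * q := by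
  obtain ⟨g, hg⟩ := h
  obtain ⟨l, g', hg'⟩ := g.exists_T_pow
  refine ⟨k + l, g', toLaurent_injective ?_⟩
  rw [map_mul, map_mul, hp, hg', hg, map_pow, toLaurent_X, LaurentPolynomial.T_pow, mul_one,
    Nat.cast_add, LaurentPolynomial.T_add]
  ring

theorem logMahler_eq_logMahlerMeasure {f : LaurentPolynomial ℤ} {p : ℤ[X]} {k : ℕ}
    (hp : toLaurent p = f * T k) :
    logMahler f = (p.map (Int.castRingHom ℂ)).logMahlerMeasure := by
  rw [logMahlerMeasure_def, Real.circleAverage_def, logMahler]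
  have h := intervalIntegral.integral_comp_mul_left (a := 0) (b := 1)
    (fun θ => Real.log ‖eval (circleMap 0 1 θ) (p.map (Int.castRingHom ℂ))‖)
    Real.two_pi_pos.ne'
  rw [mul_zero, mul_one] at h
  rw [← h]
  refine intervalIntegral.integral_congr fun t _ => ?_
  set u : ℂˣ := Units.mk0 (Complex.exp (2 * Real.pi * Complex.I * t)) (Complex.exp_ne_zero _)
  have hu : ‖(u : ℂ)‖ = 1 := by
    have : (u : ℂ) = Complex.exp ((2 * Real.pi * t : ℝ) * Complex.I) := by
      simp only [u, Units.val_mk0]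
      congr 1
      push_cast
      ring
    rw [this, Complex.norm_exp_ofReal_mul_I]
  have h1 := congrArg (fun g => ‖LaurentPolynomial.eval₂ (Int.castRingHom ℂ) u g‖) hp
  simp only [map_mul, norm_mul, LaurentPolynomial.eval₂_toLaurent, LaurentPolynomial.eval₂_T_n,
    norm_pow, hu, one_pow, mul_one] at h1
  have hcirc : circleMap 0 1 (2 * Real.pi * t) = u := by
    simp only [circleMap, u, Units.val_mk0, Complex.ofReal_one, one_mul, zero_add]
    congr 1
    push_cast
    ring
  simp only [← h1, eval_map, hcirc]

/-- By Jensen's formula the measure is `log |lc| + ∑ log⁺ ‖ζ‖` over the roots, and a positive sum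
has a positive term. -/
theorem exists_root_or_two_le_leadingCoeff {p : ℤ[X]}
    (hp : 0 < (p.map (Int.castRingHom ℂ)).logMahlerMeasure) :
    2 ≤ |p.leadingCoeff| ∨ ∃ ζ : ℂ, aeval ζ p = 0 ∧ 1 < ‖ζ‖ := by
  by_contra! h
  have hinj : Function.Injective (Int.castRingHom ℂ) := RingHom.injective_int _
  have hp0 : p ≠ 0 := by
    rintro rfl
    simp at hp
  have hlc : |p.leadingCoeff| = 1 :=
    le_antisymm (by lia) (Int.one_le_abs (leadingCoeff_ne_zero.2 hp0))
  rw [logMahlerMeasure_eq_log_leadingCoeff_add_sum_log_roots,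
    leadingCoeff_map_of_injective hinj, eq_intCast, Complex.norm_intCast, ← Int.cast_abs, hlc,
    Int.cast_one, Real.log_one, zero_add, Multiset.map_congr rfl (g := fun _ => (0 : ℝ))] at hp
  · simp at hp
  · intro ζ hζ
    refine Real.posLog_eq_zero_iff _ |>.2 ?_
    rw [abs_norm]
    refine h.2 ζ ?_
    have := (mem_roots'.1 hζ).2
    rwa [IsRoot, eval_map, ← algebraMap_int_eq, ← aeval_def] at this

/-- If `f` has positive Mahler measure and is not divisible by `2`, then along some progression
the powers of `T` are dissociate modulo `f`, and no two distinct powers agree up to sign. -/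
theorem exists_gap_of_logMahler_pos {f : LaurentPolynomial ℤ} (hf : 0 < logMahler f)
    (hf2 : ¬ LaurentPolynomial.C 2 ∣ f) :
    ∃ N : ℕ, 0 < N ∧
      (∀ q : ℤ[X], q ≠ 0 → (∀ i, |q.coeff i| ≤ 2) → ¬ f ∣ toLaurent (expand ℤ N q)) ∧
      (∀ n : ℕ, ¬ f ∣ toLaurent (X ^ n)) ∧
      ∀ n l : ℕ, n ≠ l → ¬ f ∣ toLaurent (X ^ n + X ^ l) ∧ ¬ f ∣ toLaurent (X ^ n - X ^ l) := by
  obtain ⟨k, p, hp⟩ := f.exists_T_pow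
  have key : ∀ {q : ℤ[X]}, (∀ s, ¬ p ∣ X ^ s * q) → ¬ f ∣ toLaurent q := fun hq hd =>
    let ⟨s, hs⟩ := LaurentPolynomial.exists_dvd_X_pow_mul hp hd
    hq s hs
  have hp2 : ¬ C 2 ∣ p := by
    rintro ⟨r, rfl⟩
    refine hf2 ⟨toLaurent r * T (-k), ?_⟩
    have h1 := congrArg (· * T (-k : ℤ)) hp
    simp only [map_mul, toLaurent_C, mul_assoc, ← LaurentPolynomial.T_add, add_neg_cancel,
      LaurentPolynomial.T_zero, mul_one] at h1
    exact h1.symm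
  rw [logMahler_eq_logMahlerMeasure hp] at hf
  by_cases! hlc : 2 ≤ |p.leadingCoeff|
  · have hunit : ∀ q : ℤ[X], |q.leadingCoeff| = 1 → ¬ f ∣ toLaurent q := fun q hq =>
      key (not_dvd_X_pow_mul_of_leadingCoeff (by rintro rfl; simp at hq) (by lia))
    have hlt : ∀ n l : ℕ, l < n → |(X ^ n + X ^ l : ℤ[X]).leadingCoeff| = 1 ∧
        |(X ^ n - X ^ l : ℤ[X]).leadingCoeff| = 1 := by
      intro n l hl
      have hdeg : (X ^ l : ℤ[X]).degree < (X ^ n : ℤ[X]).degree := by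
        simpa using hl
      rw [leadingCoeff_add_of_degree_lt' hdeg, leadingCoeff_sub_of_degree_lt hdeg,
        leadingCoeff_X_pow]
      simp
    have hpow : ∀ n : ℕ, ¬ f ∣ toLaurent (X ^ n) := fun n => hunit _ (by simp)
    have hpair : ∀ n l : ℕ, n ≠ l →
        ¬ f ∣ toLaurent (X ^ n + X ^ l) ∧ ¬ f ∣ toLaurent (X ^ n - X ^ l) := by
      intro n l hnl
      rcases hnl.lt_or_gt with h | h
      · refine ⟨hunit _ ?_, hunit _ ?_⟩
        · rw [add_comm]
          exact (hlt l n h).1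
        · rw [← neg_sub, leadingCoeff_neg, abs_neg]
          exact (hlt l n h).2
      · exact ⟨hunit _ (hlt n l h).1, hunit _ (hlt n l h).2⟩
    rcases hlc.eq_or_lt with hlc | hlc
    · exact ⟨p.natDegree + 1, Nat.succ_pos _, fun q hq hq2 => key
        (not_dvd_X_pow_mul_expand_of_leadingCoeff_eq_two hlc.symm hp2 hq hq2), hpow, hpair⟩
    · refine ⟨1, one_pos, fun q hq hq2 => ?_, hpow, hpair⟩
      rw [expand_one]
      exact key (not_dvd_X_pow_mul_of_leadingCoeff hq ((hq2 _).trans_lt hlc))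
  · obtain ⟨ζ, hζ, hζ1⟩ := (exists_root_or_two_le_leadingCoeff hf).resolve_left hlc.not_ge
    have hζ0 : ζ ≠ 0 := by
      rintro rfl
      norm_num at hζ1
    -- A relation `q(ζ^N) = 0` would make `ζ ^ N` a root of `q`, of norm below 3.
    obtain ⟨N, hN⟩ := pow_unbounded_of_one_lt 3 hζ1
    have hinj : ∀ n l : ℕ, n ≠ l → ‖ζ ^ n‖ ≠ ‖ζ ^ l‖ := fun n l hnl h =>
      hnl (pow_right_injective₀ (by linarith) hζ1.ne' (by simpa using h))
    refine ⟨N, Nat.pos_of_ne_zero ?_, fun q hq hq2 =>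
      key (not_dvd_X_pow_mul_of_aeval_ne_zero hζ hζ0 fun h0 => ?_),
      fun n => key (not_dvd_X_pow_mul_of_aeval_ne_zero hζ hζ0 (by simp [hζ0])),
      fun n l hnl => ⟨key (not_dvd_X_pow_mul_of_aeval_ne_zero hζ hζ0 fun h0 => ?_),
        key (not_dvd_X_pow_mul_of_aeval_ne_zero hζ hζ0 fun h0 => ?_)⟩⟩
    · rintro rfl
      norm_num at hN
    · rw [expand_aeval] at h0
      have := norm_lt_three_of_isRoot hq hq2 h0
      rw [norm_pow] at this
      exact hN.not_gt this
    · simp only [map_add, map_pow, aeval_X] at h0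
      exact hinj n l hnl (by rw [eq_neg_of_add_eq_zero_left h0, norm_neg])
    · simp only [map_sub, map_pow, aeval_X] at h0
      exact hinj n l hnl (by rw [sub_eq_zero.1 h0])

end Divisibility

/-! ### Characters of `X_f` and Haar measure -/

section Characters

open MeasureTheory Topology

variable (f : LaurentPolynomial ℤ)

/-- The pairing `⟨g, x⟩ = ∑ₘ gₘ xₘ` of a Laurent polynomial and a point of `X_f`. -/
noncomputable def principalPairing : LaurentPolynomial ℤ →+ principalGroup f →+ UnitAddCircle :=
  AddMonoidHom.mk' (fun g => AddMonoidHom.mk' (fun x => g.coeff.sum fun m c => c • x.1 m)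
    fun x y => by simp [smul_add, Finsupp.sum_add]) fun g h => by
    ext x
    exact Finsupp.sum_add_index' (h := fun m (c : ℤ) => c • x.1 m)
      (fun m => zero_smul ℤ (x.1 m)) fun m b c => add_smul b c (x.1 m)

theorem principalPairing_apply (g : LaurentPolynomial ℤ) (x : principalGroup f) :
    principalPairing f g x = g.coeff.sum fun m c => c • x.1 m := rfl

theorem principalPairing_T (n : ℤ) (x : principalGroup f) :
    principalPairing f (LaurentPolynomial.T n) x = x.1 n := by
  rw [principalPairing_apply, LaurentPolynomial.T, AddMonoidAlgebra.coeff_single]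
  simp

theorem continuous_principalPairing (g : LaurentPolynomial ℤ) :
    Continuous (principalPairing f g) :=
  continuous_finsetSum _ fun m _ =>
    ((continuous_apply m).comp continuous_subtype_val).zsmul _

/-- The character `x ↦ exp (2πi ⟨g, x⟩)` of `X_f`. -/
noncomputable def principalCharacter : AddChar (LaurentPolynomial ℤ) C(principalGroup f, ℂ) where
  toFun g := ⟨fun x => (principalPairing f g x).toCircle,
    continuous_subtype_val.comp
      (AddCircle.continuous_toCircle.comp (continuous_principalPairing f g))⟩
  map_zero_eq_one' := by ext; simp
  map_add_eq_mul' g h := by ext; simp [AddCircle.toCircle_add]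

theorem principalCharacter_apply (g : LaurentPolynomial ℤ) (x : principalGroup f) :
    principalCharacter f g x = (principalPairing f g x).toCircle := rfl

theorem norm_principalCharacter_apply (g : LaurentPolynomial ℤ) (x : principalGroup f) :
    ‖principalCharacter f g x‖ = 1 := Circle.norm_coe _

theorem principalCharacter_apply_add (g : LaurentPolynomial ℤ) (x y : principalGroup f) :
    principalCharacter f g (x + y) = principalCharacter f g x * principalCharacter f g y := by
  simp [principalCharacter_apply, AddCircle.toCircle_add]

/-- The characters of `ℤ[z^{±1}] / (f)` are points of `X_f`, and they separate points. -/
theorem exists_principalPairing_ne_zero {g : LaurentPolynomial ℤ} (hg : ¬ f ∣ g) :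
    ∃ x : principalGroup f, principalPairing f g x ≠ 0 := by
  let π := Ideal.Quotient.mk (Ideal.span {f})
  have hπ : π g ≠ 0 := by
    rwa [Ne, Ideal.Quotient.eq_zero_iff_mem, Ideal.mem_span_singleton]
  obtain ⟨θ, hθ⟩ := CharacterModule.exists_character_apply_ne_zero_of_ne_zero hπ
  -- `CharacterModule` takes values in `ℚ/ℤ`; the embedding into `ℝ/ℤ` keeps the value at `g`
  -- non-zero.
  let ι : AddCircle (1 : ℚ) →+ UnitAddCircle := QuotientAddGroup.map _ _
    (Rat.castHom ℝ).toAddMonoidHom (by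
      rw [AddSubgroup.zmultiples_le]
      exact AddSubgroup.mem_comap.2 ⟨1, by simp⟩)
  have hι : Function.Injective ι := by
    rw [injective_iff_map_eq_zero]
    intro y hy
    induction y using QuotientAddGroup.induction_on with
    | H y =>
      have hy' : (((y : ℚ) : ℝ) : UnitAddCircle) = 0 := hy
      obtain ⟨n, hn⟩ := (AddCircle.coe_eq_zero_iff _).1 hy'
      refine (AddCircle.coe_eq_zero_iff _).2 ⟨n, ?_⟩
      have : ((n : ℤ) : ℝ) = (y : ℝ) := by simpa using hn
      have : (n : ℚ) = y := by exact_mod_cast this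
      simpa using this
  let Θ : LaurentPolynomial ℤ →+ UnitAddCircle := (ι.comp θ).comp π.toAddMonoidHom
  have hΘ : ∀ (h : LaurentPolynomial ℤ) (n : ℤ),
      h.coeff.sum (fun m c => c • Θ (LaurentPolynomial.T (n + m))) =
        Θ (h * LaurentPolynomial.T n) := by
    intro h n
    induction h using LaurentPolynomial.induction_on' with
    | add p q hp hq =>
      rw [add_mul, map_add, ← hp, ← hq]
      exact Finsupp.sum_add_index' (by simp) (by simp [add_smul])
    | C_mul_T m c =>
      rw [← LaurentPolynomial.single_eq_C_mul_T, AddMonoidAlgebra.coeff_single,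
        Finsupp.sum_single_index (by simp), LaurentPolynomial.single_eq_C_mul_T, mul_assoc,
        ← LaurentPolynomial.T_add, add_comm, ← map_zsmul]
      congr 1
      rw [zsmul_eq_mul, ← map_intCast (LaurentPolynomial.C : ℤ →+* LaurentPolynomial ℤ) c, Int.cast_id]
  refine ⟨⟨fun n => Θ (LaurentPolynomial.T n), fun n => ?_⟩, ?_⟩
  · refine (hΘ f n).trans ?_
    have : π (f * LaurentPolynomial.T n) = 0 := by
      rw [Ideal.Quotient.eq_zero_iff_mem, Ideal.mem_span_singleton]
      exact dvd_mul_right _ _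
    change ι (θ (π _)) = 0
    rw [this, map_zero, map_zero]
  · have := hΘ g 0
    simp only [zero_add, LaurentPolynomial.T_zero, mul_one] at this
    rw [principalPairing_apply, this]
    exact fun h0 => hθ (hι (h0.trans (map_zero ι).symm))

/-- For Haar measure, translation by `y` multiplies the integral by the value of the character at
`y`, which is not 1 for a suitable `y`. -/
theorem exists_probabilityMeasure_integral_principalCharacter_eq_zero :
    ∃ μ : Measure (principalGroup f), IsProbabilityMeasure μ ∧
      ∀ g, ¬ f ∣ g → ∫ x, principalCharacter f g x ∂μ = 0 := by
  let K : TopologicalSpace.PositiveCompacts (principalGroup f) := ⊤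
  refine ⟨Measure.addHaarMeasure K, ⟨Measure.addHaarMeasure_self⟩, fun g hg => ?_⟩
  obtain ⟨y, hy⟩ := exists_principalPairing_ne_zero f hg
  have h1 := integral_add_left_eq_self (μ := Measure.addHaarMeasure K)
    (fun x => principalCharacter f g x) y
  simp_rw [principalCharacter_apply_add] at h1
  rw [integral_const_mul] at h1
  have h2 : principalCharacter f g y ≠ 1 := by
    intro h
    refine hy (AddCircle.injective_toCircle one_ne_zero ?_)
    rw [AddCircle.toCircle_zero]
    exact Circle.coe_injective h
  exact (mul_left_eq_self₀.1 h1).resolve_left h2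

end Characters

/-! ### From Riesz products to Bohr chaos -/

section BohrChaos

open MeasureTheory Topology Polynomial

theorem isBoundedUnder_le_of_norm_le {E : Type*} [SeminormedAddCommGroup E] {u : ℕ → E} {C : ℝ}
    (h : ∀ N, ‖u N‖ ≤ C) : IsBoundedUnder (· ≤ ·) atTop fun N => ‖u N‖ :=
  isBoundedUnder_of ⟨C, h⟩

/-- If the integrals of uniformly bounded functions do not tend to `0`, then neither do their values
at some point. -/
theorem exists_limsup_norm_pos_of_frequently_integral {X : Type*} [MeasurableSpace X]
    (ν : Measure X) [IsProbabilityMeasure ν] {F : ℕ → X → ℂ} (hF : ∀ N, Measurable (F N))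
    {C c : ℝ} (hC : ∀ N x, ‖F N x‖ ≤ C) (hc : 0 < c)
    (hint : ∃ᶠ N in atTop, c ≤ ‖∫ x, F N x ∂ν‖) :
    ∃ x, 0 < limsup (fun N => ‖F N x‖) atTop := by
  by_contra! h
  have hlim : ∀ x, Tendsto (fun N => F N x) atTop (𝓝 0) := by
    intro x
    rw [tendsto_zero_iff_norm_tendsto_zero]
    have hle : IsBoundedUnder (· ≤ ·) atTop fun N => ‖F N x‖ :=
      isBoundedUnder_le_of_norm_le fun N => hC N x
    have hge : IsBoundedUnder (· ≥ ·) atTop fun N => ‖F N x‖ :=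
      isBoundedUnder_of ⟨0, fun N => norm_nonneg _⟩
    exact tendsto_of_le_liminf_of_limsup_le
      (le_liminf_of_le hle.isCoboundedUnder_ge (Eventually.of_forall fun N => norm_nonneg _))
      (h x) hle hge
  have hI := tendsto_integral_of_dominated_convergence (μ := ν) (fun _ => C)
    (fun N => (hF N).aestronglyMeasurable) (integrable_const C)
    (fun N => ae_of_all _ (hC N)) (ae_of_all _ hlim)
  rw [integral_zero] at hI
  obtain ⟨N, hN, hN'⟩ := (hint.and_eventually
    ((tendsto_zero_iff_norm_tendsto_zero.1 hI).eventually_lt_const hc)).exists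
  exact hN.not_gt hN'

theorem norm_average_le {E : Type*} [NormedAddCommGroup E] [NormedSpace ℝ E] {u : ℕ → E} {C : ℝ}
    (h : ∀ n, ‖u n‖ ≤ C) (N : ℕ) :
    (1 / (N : ℝ)) * ‖∑ n ∈ Finset.range N, u n‖ ≤ C := by
  have hC : 0 ≤ C := (norm_nonneg _).trans (h 0)
  rcases Nat.eq_zero_or_pos N with rfl | hN
  · simpa
  · have h1 : ‖∑ n ∈ Finset.range N, u n‖ ≤ N * C := by
      simpa using norm_sum_le_of_le (Finset.range N) fun n _ => h n
    have hN' : (0 : ℝ) < N := by exact_mod_cast hN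
    calc (1 / (N : ℝ)) * ‖∑ n ∈ Finset.range N, u n‖ ≤ 1 / (N : ℝ) * (N * C) := by gcongr
      _ = C := by field_simp

theorem IsNontrivialWeight.exists_frequently_le {w : ℕ → ℂ} (hw : IsNontrivialWeight w) :
    ∃ c : ℝ, 0 < c ∧
      ∃ᶠ N : ℕ in atTop, c ≤ (1 / (N : ℝ)) * ∑ n ∈ Finset.range N, ‖w n‖ := by
  obtain ⟨c, hc, hc'⟩ := exists_between hw.2
  refine ⟨c, hc, (frequently_lt_of_lt_limsup ?_ hc').mono fun N hN => hN.le⟩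
  exact IsBoundedUnder.isCoboundedUnder_le
    (isBoundedUnder_of ⟨0, fun N => by positivity⟩)

theorem principalCharacter_one_principalAction (f : LaurentPolynomial ℤ) (n : ℕ)
    (x : principalGroup f) :
    principalCharacter f 1 (principalAction f (Multiplicative.ofAdd (n : ℤ)) x) =
      principalCharacter f (toLaurent (X ^ n)) x := by
  have h1 : principalPairing f 1 (principalAction f (Multiplicative.ofAdd (n : ℤ)) x) =
      principalPairing f (toLaurent (X ^ n)) x := by
    rw [← LaurentPolynomial.T_zero, toLaurent_X_pow, principalPairing_T, principalPairing_T]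
    change x.1 (0 + n) = x.1 n
    rw [zero_add]
  rw [principalCharacter_apply, principalCharacter_apply, h1]

/-- If `f` is divisible by `2`, then `X_f` contains all sequences in `{0, 1/2}`. -/
theorem bohrChaotic_principalAction_of_two_dvd {f : LaurentPolynomial ℤ}
    (hf : LaurentPolynomial.C 2 ∣ f) : BohrChaotic (principalAction f) := by
  intro w hw
  obtain ⟨c, hc, hfreq⟩ := hw.exists_frequently_le
  obtain ⟨C, hC⟩ := hw.1
  -- `L` will be the real or the imaginary part: one of them carries half of the average of `‖w n‖`
  -- infinitely often.
  have key : ∀ L : ℂ →ₗ[ℝ] ℝ, (∀ z, |L z| ≤ ‖z‖) →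
      (∃ᶠ N : ℕ in atTop, c / 2 ≤ (1 / (N : ℝ)) * ∑ n ∈ Finset.range N, |L (w n)|) →
      ∃ (φ : C(principalGroup f, ℂ)) (x : principalGroup f), 0 < limsup (fun N : ℕ =>
        (1 / (N : ℝ)) * ‖∑ n ∈ Finset.range N,
          w n * φ (principalAction f (Multiplicative.ofAdd (n : ℤ)) x)‖) atTop := by
    intro L hL hLfreq
    -- The character takes the value `1` at `0` and `-1` at `1/2`, so `y` encodes the sign of `L (w
    -- n)`; the entries at negative `n` play no role.
    let y : ℤ → UnitAddCircle := fun n => if 0 ≤ L (w n.toNat) then 0 else ((1 / 2 : ℝ) :)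
    have hy : ∀ n, (2 : ℤ) • y n = 0 := by
      intro n
      simp only [y]
      split_ifs
      · simp
      · rw [← AddCircle.coe_zsmul, AddCircle.coe_eq_zero_iff]
        exact ⟨1, by norm_num⟩
    obtain ⟨g, rfl⟩ := hf
    let x : principalGroup (LaurentPolynomial.C 2 * g) := ⟨y, fun n => by
      refine Finset.sum_eq_zero fun m _ => ?_
      have h2 : (LaurentPolynomial.C 2 * g).coeff m = g.coeff m * 2 := by
        rw [← LaurentPolynomial.smul_eq_C_mul, AddMonoidAlgebra.coeff_smul, Finsupp.smul_apply,
          smul_eq_mul, mul_comm]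
      rw [h2, mul_smul, hy, smul_zero]⟩
    refine ⟨principalCharacter _ 1, x, ?_⟩
    have hχ : ∀ n : ℕ, L (w n * principalCharacter _ 1
        (principalAction _ (Multiplicative.ofAdd (n : ℤ)) x)) = |L (w n)| := by
      intro n
      rw [principalCharacter_one_principalAction, principalCharacter_apply, toLaurent_X_pow,
        principalPairing_T]
      change L (w n * (AddCircle.toCircle (if 0 ≤ L (w n) then 0 else ((1 / 2 : ℝ) :)) : Circle)) = _
      split_ifs with h
      · simp [abs_of_nonneg h]
      · have h2 : ((AddCircle.toCircle (((1 / 2 : ℝ) :) : UnitAddCircle) : Circle) : ℂ) = -1 := by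
          rw [AddCircle.toCircle_apply_mk, Circle.coe_exp, ← Complex.exp_pi_mul_I]
          congr 1
          push_cast
          ring
        rw [h2, mul_neg_one, map_neg, abs_of_neg (not_le.1 h)]
    have hbd := norm_average_le (u := fun n : ℕ => w n * principalCharacter _ 1
        (principalAction _ (Multiplicative.ofAdd (n : ℤ)) x)) (C := C)
      fun n => by simpa [norm_principalCharacter_apply] using hC n
    refine (half_pos hc).trans_le (le_limsup_of_frequently_le (hLfreq.mono fun N hN => hN.trans ?_)
      (isBoundedUnder_of ⟨C, hbd⟩))
    gcongr
    calc ∑ n ∈ Finset.range N, |L (w n)|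
        = L (∑ n ∈ Finset.range N, w n * principalCharacter _ 1
            (principalAction _ (Multiplicative.ofAdd (n : ℤ)) x)) := by
          rw [map_sum]
          exact Finset.sum_congr rfl fun n _ => (hχ n).symm
      _ ≤ _ := (le_abs_self _).trans (hL _)
  have hor : ∃ᶠ N : ℕ in atTop,
      c / 2 ≤ (1 / (N : ℝ)) * ∑ n ∈ Finset.range N, |Complex.reLm (w n)| ∨
        c / 2 ≤ (1 / (N : ℝ)) * ∑ n ∈ Finset.range N, |Complex.imLm (w n)| := by
    refine hfreq.mono fun N hN => ?_
    by_contra! h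
    have h1 : (1 / (N : ℝ)) * ∑ n ∈ Finset.range N, ‖w n‖ ≤
        (1 / (N : ℝ)) * ∑ n ∈ Finset.range N, |Complex.reLm (w n)| +
          (1 / (N : ℝ)) * ∑ n ∈ Finset.range N, |Complex.imLm (w n)| := by
      rw [← mul_add, ← Finset.sum_add_distrib]
      gcongr with n
      exact Complex.norm_le_abs_re_add_abs_im _
    linarith [h.1, h.2]
  rcases frequently_or_distrib.1 hor with h | h
  · exact key _ Complex.abs_re_le_norm h
  · exact key _ Complex.abs_im_le_norm h

/-- A combination of the `X ^ (N * k + r)` is the unit `T r` times `q(X^N)`, where `q` has the given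
coefficients. -/
theorem isDissociate_pow_of_expand_not_dvd {f : LaurentPolynomial ℤ} {N : ℕ}
    (hN : ∀ q : ℤ[X], q ≠ 0 → (∀ i, |q.coeff i| ≤ 2) → ¬ f ∣ toLaurent (expand ℤ N q)) (r : ℕ) :
    IsDissociate (Ideal.span {f}).toAddSubgroup
      fun k => toLaurent (X ^ (N * k + r) : ℤ[X]) := by
  intro K ε hε hmem
  by_contra hne
  let q : ℤ[X] := ∑ k : Fin K, C (ε k) * X ^ (k : ℕ)
  have hcoeff : ∀ i, q.coeff i = if h : i < K then ε ⟨i, h⟩ else 0 := by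
    intro i
    simp only [q, finsetSum_coeff, coeff_C_mul_X_pow]
    split_ifs with h
    · rw [Finset.sum_eq_single ⟨i, h⟩] <;> simp +contextual [Fin.ext_iff, eq_comm]
    · exact Finset.sum_eq_zero fun k _ => if_neg (by lia)
  refine hN q (fun hq => hne ?_) (fun i => ?_) ?_
  · ext k
    simpa [hq] using (hcoeff k).symm
  · rw [hcoeff]
    split_ifs
    · exact hε _
    · norm_num
  · have hsum : ∑ k : Fin K, ε k • toLaurent (X ^ (N * k + r) : ℤ[X]) =
        LaurentPolynomial.T r * toLaurent (expand ℤ N q) := by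
      rw [← toLaurent_X_pow, ← map_mul]
      simp only [q, map_sum, Finset.mul_sum, ← map_zsmul]
      refine Finset.sum_congr rfl fun k _ => congrArg _ ?_
      rw [map_mul, expand_C, map_pow, expand_X, zsmul_eq_mul, ← map_intCast (C : ℤ →+* ℤ[X]),
        Int.cast_id, pow_add, pow_mul]
      ring
    rw [hsum] at hmem
    have hd : f ∣ LaurentPolynomial.T r * toLaurent (expand ℤ N q) :=
      Ideal.mem_span_singleton.1 hmem
    exact (LaurentPolynomial.isUnit_T (r : ℤ)).dvd_mul_left.1 hd

/-- Pigeonhole over the `N` classes: if each eventually had less than its share, summing over them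
would give `∑ w < ∑ w`. The strict negation makes the signs of `w` irrelevant. -/
theorem exists_residue_frequently_le {w : ℕ → ℝ} {c : ℝ} {N : ℕ} (hN : 0 < N)
    (h : ∃ᶠ M : ℕ in atTop, c ≤ (1 / (M : ℝ)) * ∑ n ∈ Finset.range M, w n) :
    ∃ r < N, ∃ᶠ M : ℕ in atTop, c ≤ (1 / (M : ℝ)) * ∑ n ∈ Finset.range M, w n ∧
      (1 / (N : ℝ)) * ∑ n ∈ Finset.range M, w n ≤
        ∑ n ∈ Finset.range M, if n % N = r then w n else 0 := by
  by_contra! hr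
  have hev : ∀ᶠ M : ℕ in atTop, ∀ r ∈ Finset.range N,
      c ≤ (1 / (M : ℝ)) * ∑ n ∈ Finset.range M, w n →
        (∑ n ∈ Finset.range M, if n % N = r then w n else 0) <
          (1 / (N : ℝ)) * ∑ n ∈ Finset.range M, w n :=
    (Finset.eventually_all _).2 fun r hr' => hr r (Finset.mem_range.1 hr')
  obtain ⟨M, hM, hM'⟩ := (h.and_eventually hev).exists
  have hlt := fun r hr' => hM' r hr' hM
  have h1 := Finset.sum_lt_sum_of_nonempty (Finset.nonempty_range_iff.2 hN.ne') hlt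
  rw [Finset.sum_comm, Finset.sum_const, Finset.card_range, nsmul_eq_mul] at h1
  have h2 : ∀ n ∈ Finset.range M, (∑ r ∈ Finset.range N, if n % N = r then w n else 0) = w n :=
    fun n _ => by simp [Nat.mod_lt n hN]
  rw [Finset.sum_congr rfl h2] at h1
  have hN' : (N : ℝ) ≠ 0 := by exact_mod_cast hN.ne'
  rw [← mul_assoc, mul_one_div_cancel hN', one_mul] at h1
  exact h1.false

theorem bohrChaotic_principalAction_of_gap {f : LaurentPolynomial ℤ} {N : ℕ} (hN : 0 < N)
    (hgap : ∀ q : ℤ[X], q ≠ 0 → (∀ i, |q.coeff i| ≤ 2) → ¬ f ∣ toLaurent (expand ℤ N q))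
    (hpow : ∀ n : ℕ, ¬ f ∣ toLaurent (X ^ n))
    (hpair : ∀ n l : ℕ, n ≠ l →
      ¬ f ∣ toLaurent (X ^ n + X ^ l) ∧ ¬ f ∣ toLaurent (X ^ n - X ^ l)) :
    BohrChaotic (principalAction f) := by
  intro w hw
  obtain ⟨c, hc, hfreq⟩ := hw.exists_frequently_le
  obtain ⟨C, hC⟩ := hw.1
  obtain ⟨r, hr, hfreq⟩ := exists_residue_frequently_le hN hfreq
  obtain ⟨μ, hμ, hμ0⟩ := exists_probabilityMeasure_integral_principalCharacter_eq_zero f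
  have hN1 : (1 : ℝ) ≤ N := by exact_mod_cast hN
  have hN0 : (0 : ℝ) < N := one_pos.trans_le hN1
  set δ : ℝ := 1 / N with hδ
  have hδ0 : 0 < δ := by positivity
  have hδ1 : δ ≤ 1 := (div_le_one hN0).2 hN1
  have hmem : ∀ g, g ∈ (Ideal.span {f}).toAddSubgroup ↔ f ∣ g := fun g =>
    Ideal.mem_span_singleton
  -- Conjugate phase of the weight. Where the weight vanishes, division by zero gives `d k = 0`, so
  -- the bound is only `‖d k‖ ≤ 1`.
  let d : ℕ → ℂ := fun k => (starRingEnd ℂ) (w (N * k + r)) / ‖w (N * k + r)‖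
  have hd : ∀ k, ‖d k‖ ≤ 1 := fun k => by
    simpa [d] using div_self_le_one ‖w (N * k + r)‖
  have hwd : ∀ k, w (N * k + r) * d k = ‖w (N * k + r)‖ := by
    intro k
    simp only [d]
    rw [mul_div_assoc', Complex.mul_conj, Complex.normSq_eq_norm_sq]
    rcases eq_or_ne (‖w (N * k + r)‖) 0 with h | h
    · simp [h]
    · have : (‖w (N * k + r)‖ : ℂ) ≠ 0 := by exact_mod_cast h
      push_cast
      field_simp
  obtain ⟨ν, hν, hν'⟩ := exists_rieszProduct μ (B := (Ideal.span {f}).toAddSubgroup)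
    (norm_principalCharacter_apply f) (fun g hg => hμ0 g fun h => hg ((hmem g).2 h))
    (isDissociate_pow_of_expand_not_dvd hgap r) hd hδ0.le hδ1
  have hlower : ∀ n, (if n % N = r then δ / 2 * ‖w n‖ else 0) - (δ / 2) ^ 2 * ‖w n‖ ≤
      (w n * ∫ x, principalCharacter f (toLaurent (X ^ n)) x ∂(ν : Measure _)).re := by
    intro n
    split_ifs with hn
    · have hn' : N * (n / N) + r = n := by rw [← hn, Nat.div_add_mod]
      have h1 := hν (n / N)
      have h2 := hwd (n / N)
      rw [hn'] at h1 h2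
      rw [h1, mul_left_comm, h2]
      have h3 : ((δ : ℂ) / 2 * (‖w n‖ : ℂ)).re = δ / 2 * ‖w n‖ := by
        rw [← Complex.ofReal_ofNat, ← Complex.ofReal_div, ← Complex.ofReal_mul,
          Complex.ofReal_re]
      rw [h3]
      have := norm_nonneg (w n)
      have : 0 ≤ (δ / 2) ^ 2 * ‖w n‖ := by positivity
      linarith
    · have hne : ∀ k, n ≠ N * k + r := by
        rintro k rfl
        exact hn (by rw [Nat.mul_add_mod, Nat.mod_eq_of_lt hr])
      have h1 := hν' (toLaurent (X ^ n)) (fun h => hpow n ((hmem _).1 h)) fun k => by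
        rw [hmem, hmem, ← map_add, ← map_sub]
        exact hpair n _ (hne k)
      have h2 := (abs_le.1 (Complex.abs_re_le_norm (w n *
        ∫ x, principalCharacter f (toLaurent (X ^ n)) x ∂(ν : Measure _)))).1
      rw [norm_mul] at h2
      have h3 := mul_le_mul_of_nonneg_left h1 (norm_nonneg (w n))
      linarith
  let F : ℕ → principalGroup f → ℂ := fun M x =>
    (1 / (M : ℝ)) • ∑ n ∈ Finset.range M, w n * principalCharacter f (toLaurent (X ^ n)) x
  have hFnorm : ∀ M x, ‖F M x‖ = (1 / (M : ℝ)) *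
      ‖∑ n ∈ Finset.range M, w n * principalCharacter f (toLaurent (X ^ n)) x‖ := fun M x => by
    rw [norm_smul, Real.norm_of_nonneg (by positivity)]
  have hFint : ∀ M, ∫ x, F M x ∂(ν : Measure _) = (1 / (M : ℝ)) • ∑ n ∈ Finset.range M,
      w n * ∫ x, principalCharacter f (toLaurent (X ^ n)) x ∂(ν : Measure _) := by
    intro M
    rw [integral_smul, integral_finsetSum _ fun n _ =>
      (ContinuousMap.integrable_of_compactSpace _ _).const_mul _]
    simp_rw [integral_const_mul]
  -- The chosen class has mass at least `δ` times the total, so the constant is `(δ / 2) * δ - (δ /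
  -- 2) ^ 2 = (δ / 2) ^ 2`, times `c`.
  obtain ⟨x, hx⟩ := exists_limsup_norm_pos_of_frequently_integral (ν : Measure (principalGroup f))
    (F := F) (C := C) (c := (δ / 2) ^ 2 * c) (fun M => by fun_prop) (fun M x => by
      rw [hFnorm]
      exact norm_average_le (fun n => by simpa [norm_principalCharacter_apply] using hC n) M)
    (by positivity) (hfreq.mono fun M hM => by
      refine le_trans ?_ (Complex.re_le_norm _)
      rw [hFint, Complex.smul_re, Complex.re_sum, smul_eq_mul]
      have h1 := Finset.sum_le_sum fun n (_ : n ∈ Finset.range M) => hlower n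
      rw [Finset.sum_sub_distrib, ← Finset.mul_sum] at h1
      have h2 : (∑ n ∈ Finset.range M, if n % N = r then δ / 2 * ‖w n‖ else 0) =
          δ / 2 * ∑ n ∈ Finset.range M, if n % N = r then ‖w n‖ else 0 := by
        rw [Finset.mul_sum]
        simp only [mul_ite, mul_zero]
      rw [h2] at h1
      have h3 := mul_le_mul_of_nonneg_left hM.2 (half_pos hδ0).le
      calc (δ / 2) ^ 2 * c
          ≤ (δ / 2) ^ 2 * ((1 / (M : ℝ)) * ∑ n ∈ Finset.range M, ‖w n‖) := by
            gcongr
            exact hM.1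
        _ = (1 / (M : ℝ)) * ((δ / 2) ^ 2 * ∑ n ∈ Finset.range M, ‖w n‖) := by ring
        _ ≤ _ := by
            gcongr
            have : 0 ≤ ∑ n ∈ Finset.range M, ‖w n‖ := by positivity
            nlinarith [mul_nonneg (sq_nonneg δ) this])
  refine ⟨principalCharacter f 1, x, ?_⟩
  simp_rw [principalCharacter_one_principalAction, ← hFnorm]
  exact hx

end BohrChaos

theorem theorem3p1 (f : LaurentPolynomial ℤ) (hf : 0 < logMahler f) :
    BohrChaotic (principalAction f) := by
  by_cases hf2 : LaurentPolynomial.C 2 ∣ f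
  · exact bohrChaotic_principalAction_of_two_dvd hf2
  · obtain ⟨N, hN, hgap, hpow, hpair⟩ := exists_gap_of_logMahler_pos hf hf2
    exact bohrChaotic_principalAction_of_gap hN hgap hpow hpair
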